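/- A \emph{semimagic square} is a $3\times3$ array of pairwise distinct positive integers whose three row sums and three column sums are all equal. For $t>0$ let $S_c(t)$ be the number of semimagic squares all of whose entries lie strictly between $0$ and $t$. A \emph{reduced normal} semimagic square is a $3\times 3$ array $(x_{ij})$ of pairwise distinct nonnegative integers with all row and column sums equal, such that $x_{11}=0$, the top row and the left column are increasing, and $x_{12}<x_{21}$; let $r_c(w)$ be the number of those with largest entry $w$. Put $\mathbf S_c(x)=\sum_{t>0}S_c(t)x^t$ and $\mathbf r_c(x)=\sum_{w>0}r_c(w)x^w$. (1) As formal power series, \[ \mathbf S_c(x)=72\,\frac{x^2}{(1-x)^2}\,\mathbf r_c(x) =\frac{72x^{10}\left[18x^9+46x^8+69x^7+74x^6+65x^5+46x^4+26x^3+11x^2+4x+1\right]}{(1-x^2)^2(1-x^3)^2(1-x^4)(1-x^5)} . \] (2) $S_c$ is a quasipolynomial of period $60$: there are polynomials $N_0,\dots,N_{59}$ (its constituents) with $S_c(t)=N_{t\bmod 60}(t)$ for all integers $t>0$, and no modulus smaller than $60$ admits such polynomials. The constituents are unique, they all have degree $5$, and they are given by \[ S_c(t)=\tfrac{3}{10}t^5-\tfrac{75}{8}t^4+\tfrac{331}{3}t^3-c_2(t)\,t^2+c_1(t)\,t-c_0(t),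 \] where $c_2(t)=\tfrac{5989}{10}$ for even $t$ and $c_2(t)=\tfrac{11933}{20}$ for odd $t$; the function $c_1$ has least period $6$, with $c_1(t)=1464$ if $t\equiv0,2$, $c_1(t)=1456$ if $t\equiv 4$, $c_1(t)=\tfrac{2831}{2}$ if $t\equiv1$, and $c_1(t)=\tfrac{2847}{2}$ if $t\equiv3,5 \pmod 6$; and $c_0$ has least period $60$, with values given by the following table, in which the row labelled $a$ lists $c_0(a),c_0(a+1),\dots,c_0(a+5)$: \[ \begin{array}{r|cccccc} 0 & 1296 & \tfrac{110413}{120} & \tfrac{3824}{3} & \tfrac{47727}{40} & \tfrac{18152}{15} & \tfrac{25705}{24} \\ 6 & \tfrac{6192}{5} & \tfrac{25193}{24} & \tfrac{19552}{15} & \tfrac{44847}{40} & \tfrac{3544}{3} & \tfrac{130253}{120} \\ 12 & 1296 & \tfrac{120781}{120} & \tfrac{19552}{15} & \tfrac{9315}{8} & \tfrac{16856}{15} & \tfrac{25705}{24} \\ 18 & \tfrac{6624}{5} & \tfrac{129421}{120} & \tfrac{3824}{3} & \tfrac{41391}{40} & \tfrac{3544}{3} & \tfrac{140621}{120} \\ 24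 & \tfrac{6624}{5} & \tfrac{23465}{24} & \tfrac{18256}{15} & \tfrac{9315}{8} & \tfrac{18152}{15} & \tfrac{131981}{120} \\ 30 & 1296 & \tfrac{119053}{120} & \tfrac{3824}{3} & \tfrac{44847}{40} & \tfrac{18152}{15} & \tfrac{27433}{24} \\ 36 & \tfrac{6192}{5} & \tfrac{23465}{24} & \tfrac{19552}{15} & \tfrac{47727}{40} & \tfrac{3544}{3} & \tfrac{121613}{120} \\ 42 & 1296 & \tfrac{129421}{120} & \tfrac{19552}{15} & \tfrac{8739}{8} & \tfrac{16856}{15} & \tfrac{27433}{24} \\ 48 & \tfrac{6624}{5} & \tfrac{120781}{120} & \tfrac{3824}{3} & \tfrac{44271}{40} & \tfrac{3544}{3} & \tfrac{131981}{120} \\ 54 & \tfrac{6624}{5} & \tfrac{25193}{24} & \tfrac{18256}{15} & \tfrac{8739}{8} & \tfrac{18152}{15} & \tfrac{140621}{120} \\ \end{array} \] (3) The principal constituent is $N_0(t)=\tfrac{3}{10}t^5-\tfrac{75}{8}t^4+\tfrac{331}{3}t^3-\tfrac{5989}{10}t^2+1464t-1296$, with constant term $-1296$. The \emph{order type} of a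 semimagic square is the linear ordering of its nine cells by increasing value of their entries. Exactly $1296$ linear orderings of the cells are order types of semimagic squares (with entries of any size). They form exactly $18$ classes under the $72$ symmetries of semimagic squares, which are the permutations of the cells obtained by permuting the rows, permuting the columns, and possibly reflecting in the main diagonal. -/

import Mathlib

namespace SemimagicSquare

/-- A cell of a `3 × 3` square: (row, column). -/
abbrev Cell : Type := Fin 3 × Fin 3

/-- A `3 × 3` square filled with integers. -/
abbrev Square : Type := Cell → ℤ

/-- All row sums and all column sums equal a common value, the magic sum. -/
def HasMagicLines (x : Square) : Prop :=
  ∃ s : ℤ, (∀ i : Fin 3, ∑ j : Fin 3, x (i, j) = s) ∧ (∀ j : Fin 3, ∑ i : Fin 3, x (i, j) = s)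

/-- A (strongly) semimagic square: positive integers, pairwise distinct, with equal row and column
sums. -/
def IsSemimagic (x : Square) : Prop :=
  HasMagicLines x ∧ Function.Injective x ∧ ∀ c, 0 < x c

/-- `S_c(t)`: the number of semimagic squares all of whose entries are strictly between
`0` and `t`. -/
noncomputable def cubicCount (t : ℕ) : ℕ :=
  Set.ncard {x : Square | IsSemimagic x ∧ ∀ c, x c < t}

/-- A reduced normal semimagic square: distinct entries, equal row and column sums, the smallest
entry is `0` and stands in the upper left corner, the top row and the left column are increasing,
and the second entry of the left column exceeds the second entry of the top row. -/
def IsReducedNormal (x : Square) : Prop :=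
  HasMagicLines x ∧ Function.Injective x ∧ (∀ c, 0 ≤ x c) ∧ x (0, 0) = 0 ∧
    x (0, 0) < x (0, 1) ∧ x (0, 1) < x (0, 2) ∧ x (0, 0) < x (1, 0) ∧ x (1, 0) < x (2, 0) ∧
    x (0, 1) < x (1, 0)

/-- `r_c(w)`: the number of reduced normal semimagic squares whose largest entry is `w`. -/
noncomputable def reducedNormalCount (w : ℕ) : ℕ :=
  Set.ncard {x : Square | IsReducedNormal x ∧ IsGreatest (Set.range x) (w : ℤ)}

/-- The generating function `∑_{t > 0} N(t) x^t`. -/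
noncomputable def genFun (N : ℕ → ℕ) : PowerSeries ℚ :=
  PowerSeries.mk fun t => if t = 0 then 0 else (N t : ℚ)

/-- `N(t) = P_{t mod p}(t)` for all `t > 0`: the polynomials `P 0, …, P (p - 1)` represent `N` as a
quasipolynomial with respect to the modulus `p`. (The values `P r` for `p ≤ r` play no role.) -/
def IsConstituents (N : ℕ → ℕ) (p : ℕ) (P : ℕ → Polynomial ℚ) : Prop :=
  0 < p ∧ ∀ t : ℕ, 0 < t → (N t : ℚ) = (P (t % p)).eval (t : ℚ)

/-- `p` is the period of the quasipolynomial `N`: the least modulus for which there are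
constituents. -/
def HasQuasiPeriod (N : ℕ → ℕ) (p : ℕ) : Prop :=
  IsLeast {q : ℕ | ∃ P : ℕ → Polynomial ℚ, IsConstituents N q P} p

/-- `p` is the least positive period of `c`. -/
def HasMinimalPeriod (c : ℕ → ℚ) (p : ℕ) : Prop :=
  IsLeast {q : ℕ | 0 < q ∧ Function.Periodic c q} p

/-- Minus the coefficient of `t ^ 2`. -/
def c₂ (t : ℕ) : ℚ := if Even t then 5989 / 10 else 11933 / 20

/-- The coefficient of `t`. -/
def c₁ (t : ℕ) : ℚ :=
  match t % 6 with
  | 0 | 2 => 1464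
  | 4 => 1456
  | 1 => 2831 / 2
  | _ => 2847 / 2

/-- The values of `c₀` at `0, 1, …, 59`. -/
def c₀Table : List ℚ :=
  [1296, 110413 / 120, 3824 / 3, 47727 / 40, 18152 / 15, 25705 / 24,
   6192 / 5, 25193 / 24, 19552 / 15, 44847 / 40, 3544 / 3, 130253 / 120,
   1296, 120781 / 120, 19552 / 15, 9315 / 8, 16856 / 15, 25705 / 24,
   6624 / 5, 129421 / 120, 3824 / 3, 41391 / 40, 3544 / 3, 140621 / 120,
   6624 / 5, 23465 / 24, 18256 / 15, 9315 / 8, 18152 / 15, 131981 / 120,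
   1296, 119053 / 120, 3824 / 3, 44847 / 40, 18152 / 15, 27433 / 24,
   6192 / 5, 23465 / 24, 19552 / 15, 47727 / 40, 3544 / 3, 121613 / 120,
   1296, 129421 / 120, 19552 / 15, 8739 / 8, 16856 / 15, 27433 / 24,
   6624 / 5, 120781 / 120, 3824 / 3, 44271 / 40, 3544 / 3, 131981 / 120,
   6624 / 5, 25193 / 24, 18256 / 15, 8739 / 8, 18152 / 15, 140621 / 120]

/-- Minus the constant term; it depends on `t` modulo `60`. -/
def c₀ (t : ℕ) : ℚ := c₀Table.getD (t % 60) 0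

open Polynomial in
/-- The constituent of `S_c` belonging to the residue class of `r` modulo `60`. -/
noncomputable def constituent (r : ℕ) : Polynomial ℚ :=
  C (3 / 10) * X ^ 5 - C (75 / 8) * X ^ 4 + C (331 / 3) * X ^ 3 - C (c₂ r) * X ^ 2
    + C (c₁ r) * X - C (c₀ r)

/-- The order type of a square: the ordering of its cells by increasing value of their entries,
as a (strict) order relation on the cells. -/
def orderType (x : Square) : Cell → Cell → Prop := fun a b => x a < x b

/-- The order types of all semimagic squares (with no bound on the entries). -/
def orderTypes : Set (Cell → Cell → Prop) :=
  {R | ∃ x : Square, IsSemimagic x ∧ R = orderType x}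

/-- The symmetries of semimagic squares: permute the rows, permute the columns, and possibly flip
the square over its main diagonal. -/
def symmetries : Set (Equiv.Perm Cell) :=
  {g | ∃ ρ κ : Equiv.Perm (Fin 3), g = Equiv.prodCongr ρ κ ∨
    g = (Equiv.prodComm (Fin 3) (Fin 3)).trans (Equiv.prodCongr ρ κ)}

/-- The symmetry class of an ordering `R` of the cells. -/
def symmetryClass (R : Cell → Cell → Prop) : Set (Cell → Cell → Prop) :=
  {R' | ∃ g ∈ symmetries, R' = fun a b => R (g a) (g b)}

end SemimagicSquare

/-!
The proof rests on an explicit description of the reduced normal squares. In such a square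
the entries `f = x₂₃` and `g = x₃₃` and the differences `p = x₃₂ - x₂₃`, `q = x₃₁ - x₂₁` determine
everything else (`squareOf`). Normality amounts to `f, g, p, q > 0`, the largest entry is
`f + g + 2p + q`, and the entries are distinct exactly when `(f, g, p, q)` avoids seven hyperplanes
(`isReducedNormal_squareOf`, `exists_squareOf_eq`).

*Generating functions.* The hyperplanes cut the positive orthant into eighteen cones. After one
further cut these are all unimodular and simplicial, so that their lattice points are parametrized
by `ℕ ^ 4` and have generating functions `x ^ c / ∏ (1 - x ^ kᵢ)`. Adding these up gives the generating
function of the reduced normal squares (`weightSeries_isAdmissible`). Every injective square has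
exactly one normal form under the 72 symmetries (`exists_symmetry_isNormalOrder`,
`symmetry_unique`). A semimagic square with entries below `t` thus amounts to a symmetry, a reduced
normal square, and two natural numbers: the excess of the least entry over `1` and the excess of
`t - 1` over the largest entry. This is the factor `72 x² / (1 - x)²` (`genFun_cubicCount`).

*Quasipolynomial.* The constituents satisfy the linear recurrence given by the denominator of the
generating function (`quasiPoly_recurrence`), because the coefficients that vary are periodic, so
that only finitely many values have to be looked at. Constituents with respect to any modulus `q`
agree with the given ones at infinitely many places; hence `c₀` has period `q`, which forces
`60 ≤ q`.

*Order types.* On each of the eighteen cones the order of the nine entries is constant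
(`exists_strictMono_squareOf_comp_chain`), and different cones have different orders. By uniqueness
of normal forms, order types of semimagic squares correspond to pairs of a symmetry and a cone
(`bijOn_orderTypeOf`), and their symmetry classes to the cones.
-/

namespace SemimagicSquare

open PowerSeries Set

/-! ### Generating functions of weighted sets -/

section WeightSeries

variable {α β : Type*}

/-- The generating function `∑_{a ∈ S} x ^ w(a)` of a set whose elements carry natural-number
weights. The coefficients are meaningful when each weight occurs finitely often. -/
noncomputable def weightSeries (S : Set α) (w : α → ℕ) : PowerSeries ℚ :=
  PowerSeries.mk fun n => ((S ∩ w ⁻¹' {n}).ncard : ℚ)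

/-- Only finitely many elements of `S` have any given weight. -/
def FiniteFibers (S : Set α) (w : α → ℕ) : Prop := ∀ n, (S ∩ w ⁻¹' {n}).Finite

theorem weightSeries_congr_bijOn {S : Set α} {T : Set β} {w : α → ℕ} {w' : β → ℕ} {φ : α → β}
    (hφ : BijOn φ S T) (hw : ∀ a ∈ S, w' (φ a) = w a) :
    weightSeries T w' = weightSeries S w := by
  ext n
  simp only [weightSeries, coeff_mk, Nat.cast_inj]
  have : T ∩ w' ⁻¹' {n} = φ '' (S ∩ w ⁻¹' {n}) := by
    ext b
    constructor
    · rintro ⟨hb, hn⟩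
      obtain ⟨a, ha, rfl⟩ := hφ.surjOn hb
      exact ⟨a, ⟨ha, (hw a ha).symm.trans hn⟩, rfl⟩
    · rintro ⟨a, ⟨ha, hn⟩, rfl⟩
      exact ⟨hφ.mapsTo ha, (hw a ha).trans hn⟩
  rw [this, (hφ.injOn.mono inter_subset_left).ncard_image]

theorem FiniteFibers.mono {S T : Set α} {w : α → ℕ} (h : FiniteFibers T w) (hST : S ⊆ T) :
    FiniteFibers S w :=
  fun n => (h n).subset (inter_subset_inter_left _ hST)

theorem weightSeries_split {S : Set α} {w : α → ℕ} (h : FiniteFibers S w) (P : α → Prop) :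
    weightSeries S w = weightSeries {a ∈ S | P a} w + weightSeries {a ∈ S | ¬ P a} w := by
  ext n
  simp only [weightSeries, map_add, coeff_mk]
  rw [← Nat.cast_add, Nat.cast_inj, ← ncard_union_eq ?_ (h.mono (sep_subset _ _) n)
    (h.mono (sep_subset _ _) n)]
  · congr 1
    ext a
    simp only [mem_union, mem_inter_iff, mem_ofPred_eq]
    tauto
  · rw [Set.disjoint_left]
    rintro a ⟨⟨-, h1⟩, -⟩ ⟨⟨-, h2⟩, -⟩
    exact h2 h1

theorem FiniteFibers.prod {S : Set α} {T : Set β} {w : α → ℕ} {w' : β → ℕ}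
    (hS : FiniteFibers S w) (hT : FiniteFibers T w') :
    FiniteFibers (S ×ˢ T) fun x => w x.1 + w' x.2 := by
  intro n
  refine ((finite_Iic n).biUnion fun i _ => (finite_Iic n).biUnion fun j _ =>
    (hS i).prod (hT j)).subset ?_
  rintro ⟨a, b⟩ ⟨⟨ha, hb⟩, hn⟩
  simp only [mem_preimage, mem_singleton_iff] at hn
  simp only [mem_iUnion]
  exact ⟨w a, by simp; omega, w' b, by simp; omega, ⟨ha, rfl⟩, ⟨hb, rfl⟩⟩

theorem weightSeries_prod {S : Set α} {T : Set β} {w : α → ℕ} {w' : β → ℕ}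
    (hS : FiniteFibers S w) (hT : FiniteFibers T w') :
    weightSeries (S ×ˢ T) (fun x => w x.1 + w' x.2) = weightSeries S w * weightSeries T w' := by
  classical
  ext n
  simp only [weightSeries, coeff_mul, coeff_mk]
  have hfin := hS.prod hT n
  rw [ncard_eq_toFinset_card _ hfin,
    Finset.card_eq_sum_card_fiberwise (f := fun x => (w x.1, w' x.2))
      (t := Finset.HasAntidiagonal.antidiagonal n) ?_, Nat.cast_sum]
  · refine Finset.sum_congr rfl fun ij hij => ?_
    rw [← Nat.cast_mul, ← ncard_prod, ← ncard_coe_finset, Nat.cast_inj]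
    congr 1
    ext ⟨a, b⟩
    rw [Finset.HasAntidiagonal.mem_antidiagonal] at hij
    simp only [Finset.coe_filter, Finite.mem_toFinset, mem_ofPred_eq, mem_inter_iff, mem_prod,
      mem_preimage, mem_singleton_iff, Prod.ext_iff]
    constructor
    · rintro ⟨⟨⟨ha, hb⟩, -⟩, h1, h2⟩
      exact ⟨⟨ha, h1⟩, ⟨hb, h2⟩⟩
    · rintro ⟨⟨ha, h1⟩, ⟨hb, h2⟩⟩
      exact ⟨⟨⟨ha, hb⟩, by omega⟩, h1, h2⟩
  · intro x hx
    simpa using ((Finite.mem_toFinset _).1 hx).2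

theorem weightSeries_const_add (S : Set α) (w : α → ℕ) (c : ℕ) :
    weightSeries S (fun a => c + w a) = X ^ c * weightSeries S w := by
  ext n
  simp only [weightSeries, coeff_X_pow_mul', coeff_mk]
  split_ifs with h
  · congr 2
    ext a
    simp only [mem_inter_iff, mem_preimage, mem_singleton_iff]
    exact and_congr_right fun _ => by omega
  · rw [Nat.cast_eq_zero]
    convert ncard_empty α
    ext a
    simp only [mem_inter_iff, mem_preimage, mem_singleton_iff, mem_empty_iff_false,
      iff_false, not_and]
    intro _
    omega

theorem FiniteFibers.of_finite {S : Set α} (h : S.Finite) (w : α → ℕ) : FiniteFibers S w :=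
  fun _ => h.subset inter_subset_left

theorem weightSeries_zero (S : Set α) :
    weightSeries S (fun _ => 0) = (S.ncard : PowerSeries ℚ) := by
  ext n
  rw [← map_natCast (C (R := ℚ)), coeff_C]
  simp only [weightSeries, coeff_mk]
  split_ifs with h
  · simp [h]
  · simp [Ne.symm h]

theorem finiteFibers_nat {k : ℕ} (hk : 0 < k) : FiniteFibers univ fun n : ℕ => k * n := by
  intro n
  refine (finite_Iic n).subset ?_
  rintro m ⟨-, hm⟩
  simp only [mem_preimage, mem_singleton_iff] at hm
  exact le_trans (Nat.le_mul_of_pos_left m hk) hm.le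

/-- The geometric series. -/
theorem weightSeries_nat {k : ℕ} (hk : 0 < k) :
    weightSeries univ (fun n : ℕ => k * n) * (1 - X ^ k) = 1 := by
  -- A natural number is either zero or a successor, and the successors have weight `k + k * n`.
  have h := weightSeries_split (finiteFibers_nat hk) (fun n => n = 0)
  have h0 : weightSeries {n ∈ (univ : Set ℕ) | n = 0} (fun n : ℕ => k * n) = 1 := by
    have : weightSeries ({0} : Set ℕ) (fun n : ℕ => k * n) = weightSeries {()} fun _ => 0 :=
      weightSeries_congr_bijOn (φ := fun _ => 0) (by simp [BijOn, MapsTo, InjOn, SurjOn]) (by simp)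
    simpa [weightSeries_zero] using this
  have h1 : weightSeries {n ∈ (univ : Set ℕ) | ¬ n = 0} (fun n : ℕ => k * n) =
      X ^ k * weightSeries univ (fun n : ℕ => k * n) := by
    rw [← weightSeries_const_add]
    refine weightSeries_congr_bijOn (φ := fun n => n + 1)
      ⟨fun n _ => by simp, fun a _ b _ => by simp, fun n hn => ⟨n - 1, trivial, ?_⟩⟩
      fun n _ => by ring
    have : n ≠ 0 := hn.2
    dsimp only
    omega
  rw [h0, h1] at h
  linear_combination h

/-- The generating function of a set that is parametrized bijectively by `ℕ ^ 4` in such a way that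
the weight is an affine function of the parameters. -/
theorem weightSeries_of_simplicial {S : Set α} {w : α → ℕ} (φ : ℕ × ℕ × ℕ × ℕ → α)
    (ψ : α → ℕ × ℕ × ℕ × ℕ) (c k₁ k₂ k₃ k₄ : ℕ)
    (hk : 0 < k₁ ∧ 0 < k₂ ∧ 0 < k₃ ∧ 0 < k₄)
    (hφ : ∀ n, φ n ∈ S) (hψφ : ∀ n, ψ (φ n) = n) (hφψ : ∀ v ∈ S, φ (ψ v) = v)
    (hw : ∀ n₁ n₂ n₃ n₄, w (φ (n₁, n₂, n₃, n₄)) =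
      c + (k₁ * n₁ + (k₂ * n₂ + (k₃ * n₃ + k₄ * n₄)))) :
    weightSeries S w * ((1 - X ^ k₁) * (1 - X ^ k₂) * (1 - X ^ k₃) * (1 - X ^ k₄)) = X ^ c := by
  obtain ⟨hk₁, hk₂, hk₃, hk₄⟩ := hk
  have hbij : BijOn φ (univ ×ˢ univ ×ˢ univ ×ˢ univ) S :=
    ⟨fun n _ => hφ n, fun a _ b _ h => by rw [← hψφ a, h, hψφ],
      fun v hv => ⟨ψ v, by simp, hφψ v hv⟩⟩
  have h₁ := finiteFibers_nat hk₁
  have h₂ := finiteFibers_nat hk₂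
  have h₃ := finiteFibers_nat hk₃
  have h₄ := finiteFibers_nat hk₄
  rw [weightSeries_congr_bijOn (w := fun n => c + (k₁ * n.1 + (k₂ * n.2.1 +
      (k₃ * n.2.2.1 + k₄ * n.2.2.2)))) hbij fun n _ => hw n.1 n.2.1 n.2.2.1 n.2.2.2,
    weightSeries_const_add _ fun n : ℕ × ℕ × ℕ × ℕ =>
      k₁ * n.1 + (k₂ * n.2.1 + (k₃ * n.2.2.1 + k₄ * n.2.2.2)),
    weightSeries_prod h₁ (h₂.prod (h₃.prod h₄)), weightSeries_prod h₂ (h₃.prod h₄),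
    weightSeries_prod h₃ h₄]
  calc _ = X ^ c * (weightSeries univ (fun n : ℕ => k₁ * n) * (1 - X ^ k₁)) *
        (weightSeries univ (fun n : ℕ => k₂ * n) * (1 - X ^ k₂)) *
        (weightSeries univ (fun n : ℕ => k₃ * n) * (1 - X ^ k₃)) *
        (weightSeries univ (fun n : ℕ => k₄ * n) * (1 - X ^ k₄)) := by ring
    _ = X ^ c := by
      rw [weightSeries_nat hk₁, weightSeries_nat hk₂, weightSeries_nat hk₃, weightSeries_nat hk₄]
      ring

end WeightSeries

/-! ### Symmetries and normal forms -/

/-- The symmetry that flips the square over its main diagonal if `b` holds, and then permutes the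
rows by `ρ` and the columns by `κ`. -/
def symmetryOf (b : Bool) (ρ κ : Equiv.Perm (Fin 3)) : Equiv.Perm Cell :=
  if b then (Equiv.prodComm (Fin 3) (Fin 3)).trans (Equiv.prodCongr ρ κ) else Equiv.prodCongr ρ κ

@[simp]
theorem symmetryOf_apply (b : Bool) (ρ κ : Equiv.Perm (Fin 3)) (i j : Fin 3) :
    symmetryOf b ρ κ (i, j) = if b then (ρ j, κ i) else (ρ i, κ j) := by
  cases b <;> simp [symmetryOf]

theorem mem_symmetries_iff {g : Equiv.Perm Cell} :
    g ∈ symmetries ↔ ∃ b ρ κ, symmetryOf b ρ κ = g := by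
  simp [symmetries, symmetryOf, exists_or, eq_comm]

theorem symmetryOf_injective :
    Function.Injective fun d : Bool × Equiv.Perm (Fin 3) × Equiv.Perm (Fin 3) =>
      symmetryOf d.1 d.2.1 d.2.2 := by
  rintro ⟨b, ρ, κ⟩ ⟨b', ρ', κ'⟩ h
  have h' (i j : Fin 3) := congrArg (fun g : Equiv.Perm Cell => g (i, j)) h
  simp only [symmetryOf_apply] at h'
  -- With a flip on one side only, `ρ` would be constant.
  have key (σ τ τ' : Equiv.Perm (Fin 3)) (f : Fin 3 → Fin 3)
      (hσ : ∀ i j, (σ j, f i) = (τ i, τ' j)) : False := by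
    have h0 := (Prod.ext_iff.1 (hσ 0 0)).1
    have h1 := (Prod.ext_iff.1 (hσ 0 1)).1
    exact absurd (σ.injective (h0.trans h1.symm)) (by decide)
  cases b <;> cases b' <;> simp only [if_true, if_false, Bool.false_eq_true] at h'
  · obtain rfl : ρ = ρ' := Equiv.ext fun i => (Prod.ext_iff.1 (h' i 0)).1
    obtain rfl : κ = κ' := Equiv.ext fun i => (Prod.ext_iff.1 (h' 0 i)).2
    rfl
  · exact (key ρ' ρ κ κ' fun i j => (h' i j).symm).elim
  · exact (key ρ ρ' κ' κ h').elim
  · obtain rfl : ρ = ρ' := Equiv.ext fun i => (Prod.ext_iff.1 (h' 0 i)).1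
    obtain rfl : κ = κ' := Equiv.ext fun i => (Prod.ext_iff.1 (h' i 0)).2
    rfl

theorem ncard_symmetries : symmetries.ncard = 72 := by
  have : symmetries = range fun d : Bool × Equiv.Perm (Fin 3) × Equiv.Perm (Fin 3) =>
      symmetryOf d.1 d.2.1 d.2.2 := by
    ext g
    simp [mem_symmetries_iff]
  rw [this, ← image_univ, ncard_image_of_injective _ symmetryOf_injective, ncard_univ,
    Nat.card_eq_fintype_card]
  simp [Fintype.card_perm, Nat.factorial]

theorem finite_symmetries : symmetries.Finite := toFinite _

theorem one_mem_symmetries : (1 : Equiv.Perm Cell) ∈ symmetries :=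
  mem_symmetries_iff.2 ⟨false, 1, 1, Equiv.ext fun ⟨i, j⟩ => by simp⟩

theorem mul_mem_symmetries {g h : Equiv.Perm Cell} (hg : g ∈ symmetries) (hh : h ∈ symmetries) :
    g * h ∈ symmetries := by
  obtain ⟨b, ρ, κ, rfl⟩ := mem_symmetries_iff.1 hg
  obtain ⟨b', ρ', κ', rfl⟩ := mem_symmetries_iff.1 hh
  refine mem_symmetries_iff.2
    ⟨xor b b', ρ * (if b then κ' else ρ'), κ * (if b then ρ' else κ'), Equiv.ext fun ⟨i, j⟩ => ?_⟩
  cases b <;> cases b' <;> simp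

theorem inv_mem_symmetries {g : Equiv.Perm Cell} (hg : g ∈ symmetries) : g⁻¹ ∈ symmetries := by
  obtain ⟨b, ρ, κ, rfl⟩ := mem_symmetries_iff.1 hg
  refine mem_symmetries_iff.2
    ⟨b, if b then κ⁻¹ else ρ⁻¹, if b then ρ⁻¹ else κ⁻¹,
      eq_inv_of_mul_eq_one_left (Equiv.ext fun ⟨i, j⟩ => ?_)⟩
  cases b <;> simp

/-- An ordering of the cells is normal if the upper left cell is the least one, the top row and the
left column increase beyond it, and the second cell of the top row precedes the second cell of the
left column. -/
def IsNormalOrder (R : Cell → Cell → Prop) : Prop :=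
  (∀ c, c ≠ (0, 0) → R (0, 0) c) ∧ R (0, 1) (0, 2) ∧ R (1, 0) (2, 0) ∧ R (0, 1) (1, 0)

/-- A permutation of three indices that moves a given index to the front and puts the other two
into increasing order. -/
theorem exists_perm_sorting_tail {v : Fin 3 → ℤ} (hv : Function.Injective v) (i : Fin 3) :
    ∃ ρ : Equiv.Perm (Fin 3), ρ 0 = i ∧ v (ρ 1) < v (ρ 2) := by
  have h0 : Equiv.swap 0 i 0 = i := Equiv.swap_apply_left 0 i
  rcases lt_trichotomy (v (Equiv.swap 0 i 1)) (v (Equiv.swap 0 i 2)) with h | h | h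
  · exact ⟨_, h0, h⟩
  · exact absurd ((Equiv.swap 0 i).injective (hv h)) (by decide)
  · refine ⟨Equiv.swap 0 i * Equiv.swap 1 2, ?_, ?_⟩
    · rw [Equiv.Perm.mul_apply, show (Equiv.swap 1 2 : Equiv.Perm (Fin 3)) 0 = 0 by decide, h0]
    · simpa [Equiv.Perm.mul_apply] using h

theorem exists_symmetry_isNormalOrder {x : Square} (hx : Function.Injective x) :
    ∃ g ∈ symmetries, IsNormalOrder (orderType (x ∘ g)) := by
  obtain ⟨⟨i, j⟩, hmin⟩ := Finite.exists_min x
  obtain ⟨ρ, hρ0, hρ⟩ := exists_perm_sorting_tail (v := fun k => x (k, j))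
    (fun a b h => (Prod.ext_iff.1 (hx h)).1) i
  obtain ⟨κ, hκ0, hκ⟩ := exists_perm_sorting_tail (v := fun k => x (i, k))
    (fun a b h => (Prod.ext_iff.1 (hx h)).2) j
  have hlt (g : Equiv.Perm Cell) (hg : g (0, 0) = (i, j)) (c : Cell) (hc : c ≠ (0, 0)) :
      x (g (0, 0)) < x (g c) :=
    lt_of_le_of_ne (hg ▸ hmin _) fun h => hc (g.injective (hx h)).symm
  -- The flip decides between the second entries of the top row and of the left column.
  have hne : x (ρ 0, κ 1) ≠ x (ρ 1, κ 0) := fun h =>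
    absurd (ρ.injective (Prod.ext_iff.1 (hx h)).1) (by decide)
  rcases lt_or_gt_of_ne hne with h | h
  · refine ⟨symmetryOf false ρ κ, mem_symmetries_iff.2 ⟨_, _, _, rfl⟩,
      hlt _ (by simp [hρ0, hκ0]), ?_⟩
    simpa [orderType, hρ0, hκ0] using ⟨hκ, hρ, by simpa [hρ0, hκ0] using h⟩
  · refine ⟨symmetryOf true ρ κ, mem_symmetries_iff.2 ⟨_, _, _, rfl⟩,
      hlt _ (by simp [hρ0, hκ0]), ?_⟩
    simpa [orderType, hρ0, hκ0] using ⟨hρ, hκ, by simpa [hρ0, hκ0] using h⟩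

theorem eq_one_of_isNormalOrder_comp {x : Square} {g : Equiv.Perm Cell} (hg : g ∈ symmetries)
    (hx : IsNormalOrder (orderType x)) (hxg : IsNormalOrder (orderType (x ∘ g))) : g = 1 := by
  have h00 : g (0, 0) = (0, 0) := by
    by_contra h
    have h1 : x (0, 0) < x (g (0, 0)) := hx.1 _ h
    have h2 := hxg.1 (g⁻¹ (0, 0)) fun h' => h (Equiv.Perm.inv_eq_iff_eq.1 h').symm
    simp only [orderType, Function.comp_apply, ← Equiv.Perm.mul_apply, mul_inv_cancel,
      Equiv.Perm.one_apply] at h2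
    omega
  obtain ⟨b, ρ, κ, rfl⟩ := mem_symmetries_iff.1 hg
  have h00' : ρ 0 = 0 ∧ κ 0 = 0 := by cases b <;> simpa using h00
  have cases_of_fix (σ : Equiv.Perm (Fin 3)) (h : σ 0 = 0) : σ = 1 ∨ σ = Equiv.swap 1 2 := by
    revert σ; decide
  obtain ⟨-, hx1, hx2, hx3⟩ := hx
  obtain ⟨-, hg1, hg2, hg3⟩ := hxg
  simp only [orderType, Function.comp_apply, symmetryOf_apply] at hx1 hx2 hx3 hg1 hg2 hg3
  have h0 : (Equiv.swap 1 2 : Equiv.Perm (Fin 3)) 0 = 0 := by decide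
  -- All but the identity reverse one of the remaining three inequalities.
  rcases cases_of_fix ρ h00'.1 with rfl | rfl <;> rcases cases_of_fix κ h00'.2 with rfl | rfl <;>
    cases b <;> simp [h0] at hg1 hg2 hg3 <;>
    first
      | (exfalso; omega)
      | exact Equiv.ext fun ⟨i, j⟩ => by simp

/-- The normal form of an injective square under the symmetries is unique. -/
theorem symmetry_unique {x : Square} {g h : Equiv.Perm Cell} (hg : g ∈ symmetries)
    (hh : h ∈ symmetries) (hxg : IsNormalOrder (orderType (x ∘ g)))
    (hxh : IsNormalOrder (orderType (x ∘ h))) : g = h := by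
  have := eq_one_of_isNormalOrder_comp (mul_mem_symmetries (inv_mem_symmetries hg) hh) hxg
    (by convert hxh using 2; ext c; simp)
  exact inv_mul_eq_one.1 this

/-! ### Reduced normal squares -/

/-- The square with parameters `(f, g, p, q)`: every square with equal row and column sums whose
upper left entry is `0` has this form, except that the parameters may be negative. -/
def squareOf (v : ℕ × ℕ × ℕ × ℕ) : Square := fun c =>
  ((![![0, v.1 + v.2.1, v.1 + v.2.1 + 2 * v.2.2.1 + v.2.2.2],
      ![v.1 + v.2.1 + v.2.2.1, v.2.1 + v.2.2.1 + v.2.2.2, v.1],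
      ![v.1 + v.2.1 + v.2.2.1 + v.2.2.2, v.1 + v.2.2.1, v.2.1]] c.1 c.2 : ℕ) : ℤ)

/-- The parameters of reduced normal squares: they are positive, and they avoid the seven
hyperplanes on which two entries of the square coincide. -/
def IsAdmissible : ℕ × ℕ × ℕ × ℕ → Prop := fun (f, g, p, q) =>
  (0 < f ∧ 0 < g ∧ 0 < p ∧ 0 < q) ∧ f ≠ g ∧ f ≠ q ∧ f ≠ p + q ∧ g ≠ p ∧ f + p ≠ g ∧ f ≠ g + q ∧
    f ≠ g + p + q

/-- The upper right entry, which is the largest one. -/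
def topRight (v : ℕ × ℕ × ℕ × ℕ) : ℕ := v.1 + v.2.1 + 2 * v.2.2.1 + v.2.2.2

theorem squareOf_le_topRight (v : ℕ × ℕ × ℕ × ℕ) (c : Cell) : squareOf v c ≤ topRight v := by
  obtain ⟨i, j⟩ := c
  fin_cases i <;> fin_cases j <;> simp [squareOf, topRight] <;> omega

theorem isReducedNormal_squareOf {v : ℕ × ℕ × ℕ × ℕ} (hv : IsAdmissible v) :
    IsReducedNormal (squareOf v) := by
  obtain ⟨f, g, p, q⟩ := v
  simp only [IsAdmissible] at hv
  refine ⟨⟨2 * f + 2 * g + 2 * p + q, fun i => ?_, fun j => ?_⟩, ?_, fun c => ?_, ?_⟩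
  · fin_cases i <;> simp [squareOf, Fin.sum_univ_three] <;> ring
  · fin_cases j <;> simp [squareOf, Fin.sum_univ_three] <;> ring
  · rintro ⟨i, j⟩ ⟨i', j'⟩
    fin_cases i <;> fin_cases j <;> fin_cases i' <;> fin_cases j' <;> simp [squareOf] <;> omega
  · simp [squareOf]
  · simp [squareOf]
    omega

theorem exists_squareOf_eq {x : Square} (hx : IsReducedNormal x) :
    ∃ v, IsAdmissible v ∧ squareOf v = x := by
  obtain ⟨⟨s, hr, hc⟩, hinj, hpos, h0, h1, h2, h3, h4, h5⟩ := hx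
  have hr0 := hr 0
  have hr1 := hr 1
  have hr2 := hr 2
  have hc0 := hc 0
  have hc1 := hc 1
  have hc2 := hc 2
  simp only [Fin.sum_univ_three] at hr0 hr1 hr2 hc0 hc1 hc2
  -- The coincidences of entries that have to be excluded; the others contradict normality.
  have n1 := hinj.ne (show ((0, 0) : Cell) ≠ (1, 2) by decide)
  have n2 := hinj.ne (show ((0, 0) : Cell) ≠ (2, 2) by decide)
  have n3 := hinj.ne (show ((1, 2) : Cell) ≠ (2, 2) by decide)
  have n4 := hinj.ne (show ((0, 1) : Cell) ≠ (1, 1) by decide)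
  have n5 := hinj.ne (show ((1, 0) : Cell) ≠ (1, 1) by decide)
  have n6 := hinj.ne (show ((0, 1) : Cell) ≠ (2, 1) by decide)
  have n7 := hinj.ne (show ((2, 1) : Cell) ≠ (2, 2) by decide)
  have n8 := hinj.ne (show ((1, 1) : Cell) ≠ (2, 1) by decide)
  have n9 := hinj.ne (show ((1, 1) : Cell) ≠ (1, 2) by decide)
  have p1 := hpos (1, 2)
  have p2 := hpos (2, 2)
  -- By positivity nothing is truncated in the passage to natural numbers.
  refine ⟨((x (1, 2)).toNat, (x (2, 2)).toNat, (x (2, 1) - x (1, 2)).toNat,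
    (x (2, 0) - x (1, 0)).toNat), ?_, ?_⟩
  · simp only [IsAdmissible]
    omega
  · funext ⟨i, j⟩
    fin_cases i <;> fin_cases j <;> simp [squareOf] <;> omega

theorem squareOf_injective : Function.Injective squareOf := by
  rintro ⟨f, g, p, q⟩ ⟨f', g', p', q'⟩ h
  have h1 := congrFun h (1, 2)
  have h2 := congrFun h (2, 2)
  have h3 := congrFun h (2, 1)
  have h4 := congrFun h (2, 0)
  simp [squareOf] at h1 h2 h3 h4 ⊢
  omega

theorem isGreatest_range_squareOf_iff {v : ℕ × ℕ × ℕ × ℕ} {w : ℕ} :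
    IsGreatest (range (squareOf v)) (w : ℤ) ↔ topRight v = w := by
  have h : IsGreatest (range (squareOf v)) (topRight v : ℤ) :=
    ⟨⟨(0, 2), by simp [squareOf, topRight]⟩, by rintro - ⟨c, rfl⟩; exact squareOf_le_topRight v c⟩
  constructor
  · intro h'
    exact_mod_cast h.unique h'
  · rintro rfl
    exact h

theorem genFun_reducedNormalCount :
    genFun reducedNormalCount = weightSeries {v | IsAdmissible v} topRight := by
  ext w
  have h : reducedNormalCount w = ({v | IsAdmissible v} ∩ topRight ⁻¹' {w}).ncard := by
    rw [reducedNormalCount, ← squareOf_injective.injOn.ncard_image]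
    congr 1
    ext x
    constructor
    · rintro ⟨hx, hw⟩
      obtain ⟨v, hv, rfl⟩ := exists_squareOf_eq hx
      exact ⟨v, ⟨hv, isGreatest_range_squareOf_iff.1 hw⟩, rfl⟩
    · rintro ⟨v, ⟨hv, hw⟩, rfl⟩
      exact ⟨isReducedNormal_squareOf hv, isGreatest_range_squareOf_iff.2 hw⟩
  simp only [genFun, weightSeries, coeff_mk, ← h]
  split_ifs with hw
  · symm
    rw [h, hw, Nat.cast_eq_zero]
    convert ncard_empty (ℕ × ℕ × ℕ × ℕ) using 2
    refine eq_empty_of_forall_notMem ?_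
    rintro ⟨f, g, p, q⟩
    simp [IsAdmissible, topRight]
    omega
  · rfl

theorem finiteFibers_topRight : FiniteFibers univ topRight := by
  intro n
  refine ((finite_Iic n).prod ((finite_Iic n).prod ((finite_Iic n).prod (finite_Iic n)))).subset ?_
  rintro ⟨f, g, p, q⟩ ⟨-, h⟩
  simp only [topRight, mem_preimage, mem_singleton_iff] at h
  simp only [mem_prod, mem_Iic]
  omega

/-! ### The generating function of reduced normal squares -/

theorem weightSeries_split_mul {α : Type*} {S : Set α} {w : α → ℕ} (h : FiniteFibers univ w)
    (P : α → Prop) {D A B : PowerSeries ℚ} (hA : weightSeries {a ∈ S | P a} w * D = A)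
    (hB : weightSeries {a ∈ S | ¬ P a} w * D = B) : weightSeries S w * D = A + B := by
  rw [weightSeries_split (h.mono (subset_univ S)) P, add_mul, hA, hB]

/-- `weightSeries_of_simplicial` for sets of parameters of squares, with the conditions on the
parametrization gathered into one, and brought to a common denominator `D`. -/
theorem weightSeries_simplicial_mul {S : Set (ℕ × ℕ × ℕ × ℕ)} {w : ℕ × ℕ × ℕ × ℕ → ℕ}
    {D : PowerSeries ℚ} (φ ψ : ℕ × ℕ × ℕ × ℕ → ℕ × ℕ × ℕ × ℕ) (c k₁ k₂ k₃ k₄ : ℕ)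
    (E : PowerSeries ℚ) (hk : 0 < k₁ ∧ 0 < k₂ ∧ 0 < k₃ ∧ 0 < k₄)
    (hD : D = (1 - X ^ k₁) * (1 - X ^ k₂) * (1 - X ^ k₃) * (1 - X ^ k₄) * E)
    (h : ∀ a b d e f g p q, (φ (a, b, d, e) ∈ S ∧ ψ (φ (a, b, d, e)) = (a, b, d, e) ∧
      w (φ (a, b, d, e)) = c + (k₁ * a + (k₂ * b + (k₃ * d + k₄ * e)))) ∧
      ((f, g, p, q) ∈ S → φ (ψ (f, g, p, q)) = (f, g, p, q))) :
    weightSeries S w * D = X ^ c * E := by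
  rw [hD, ← mul_assoc, weightSeries_of_simplicial φ ψ c k₁ k₂ k₃ k₄ hk
    (fun n => (h n.1 n.2.1 n.2.2.1 n.2.2.2 0 0 0 0).1.1)
    (fun n => (h n.1 n.2.1 n.2.2.1 n.2.2.2 0 0 0 0).1.2.1)
    (fun v => (h 0 0 0 0 v.1 v.2.1 v.2.2.1 v.2.2.2).2)
    fun a b d e => (h a b d e 0 0 0 0).1.2.2]

set_option maxHeartbeats 2000000 in
/-- The seven hyperplanes cut the positive orthant into eighteen cones. All but one of them are
simplicial and unimodular; the remaining one, in which `p < g < f + p` and `q < f < g, p + q`, has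
five rays, and the hyperplane `g = p + q` cuts it into two unimodular simplicial cones, one of which
keeps the common facet. In each of the nineteen cases the parametrization is by the coefficients of
the vector with respect to the rays, diminished by one unless the facet belongs to the cone. -/
theorem weightSeries_isAdmissible :
    weightSeries {v | IsAdmissible v} topRight *
      ((1 - X ^ 2) ^ 2 * (1 - X ^ 3) ^ 2 * (1 - X ^ 4) * (1 - X ^ 5)) =
    X ^ 8 * (1 - X) ^ 2 *
      (18 * X ^ 9 + 46 * X ^ 8 + 69 * X ^ 7 + 74 * X ^ 6 + 65 * X ^ 5 + 46 * X ^ 4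
        + 26 * X ^ 3 + 11 * X ^ 2 + 4 * X + 1) := by
  refine Eq.trans
    (weightSeries_split_mul finiteFibers_topRight (fun v => v.1 < v.2.1)
     (weightSeries_split_mul finiteFibers_topRight (fun v => v.1 < v.2.2.2)
      (weightSeries_split_mul finiteFibers_topRight (fun v => v.1 + v.2.2.1 < v.2.1)
       (weightSeries_simplicial_mul
         (fun (a, b, c, d) => (d + 1, b + c + d + 3, c + 1, a + d + 2))
         (fun (f, g, p, q) => (q - f - 1, g - f - p - 1, p - 1, f - 1))
         8 1 1 3 3 ((1 + X) ^ 2 * (1 - X ^ 4) * (1 - X ^ 5)) (by decide) (by ring)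
         (by intros; simp [IsAdmissible, topRight]; omega))
       (weightSeries_split_mul finiteFibers_topRight (fun v => v.2.1 < v.2.2.1)
        (weightSeries_simplicial_mul
          (fun (a, b, c, d) => (d + 1, c + d + 2, b + c + d + 3, a + d + 2))
          (fun (f, g, p, q) => (q - f - 1, p - g - 1, g - f - 1, f - 1))
          11 1 2 3 5 ((1 + X) * (1 - X ^ 3) * (1 - X ^ 4)) (by decide) (by ring)
          (by intros; simp [IsAdmissible, topRight]; omega))
        (weightSeries_simplicial_mul
          (fun (a, b, c, d) => (c + d + 2, b + c + d + 3, b + d + 2, a + c + d + 3))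
          (fun (f, g, p, q) => (q - f - 1, g - f - 1, g - p - 1, f + p - g - 1))
          12 1 3 3 5 ((1 + X) * (1 - X ^ 2) * (1 - X ^ 4)) (by decide) (by ring)
          (by intros; simp [IsAdmissible, topRight]; omega))))
      (weightSeries_split_mul finiteFibers_topRight (fun v => v.1 < v.2.2.1 + v.2.2.2)
       (weightSeries_split_mul finiteFibers_topRight (fun v => v.1 + v.2.2.1 < v.2.1)
        (weightSeries_simplicial_mul
          (fun (a, b, c, d) => (c + d + 2, a + b + c + 2 * d + 5, b + d + 2, c + 1))
          (fun (f, g, p, q) => (g - f - p - 1, p + q - f - 1, q - 1, f - q - 1))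
          12 1 3 3 5 ((1 + X) * (1 - X ^ 2) * (1 - X ^ 4)) (by decide) (by ring)
          (by intros; simp [IsAdmissible, topRight]; omega))
        (weightSeries_split_mul finiteFibers_topRight (fun v => v.2.1 < v.2.2.1)
         (weightSeries_simplicial_mul
           (fun (a, b, c, d) => (c + d + 2, b + c + d + 3, a + b + c + d + 4, d + 1))
           (fun (f, g, p, q) => (p - g - 1, g - f - 1, f - q - 1, q - 1))
           14 2 3 4 5 ((1 - X ^ 2) * (1 - X ^ 3)) (by decide) (by ring)
           (by intros; simp [IsAdmissible, topRight]; omega))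
         (weightSeries_split_mul finiteFibers_topRight (fun v => v.2.1 < v.2.2.1 + v.2.2.2)
          (weightSeries_simplicial_mul
            (fun (a, b, c, d) => (b + c + d + 3, a + b + c + d + 4, a + c + d + 3, b + d + 2))
            (fun (f, g, p, q) => (g - f - 1, g - p - 1, f - q - 1, p + q - g - 1))
            15 3 3 4 5 ((1 - X ^ 2) ^ 2) (by decide) (by ring)
            (by intros; simp [IsAdmissible, topRight]; omega))
          (weightSeries_simplicial_mul
            (fun (a, b, c, d) => (b + c + d + 2, a + b + c + 2 * d + 3, a + c + d + 2, b + 1))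
            (fun (f, g, p, q) => (p + q - f - 1, q - 1, f + p - g - 1, g - p - q))
            10 3 3 4 5 ((1 - X ^ 2) ^ 2) (by decide) (by ring)
            (by intros; simp [IsAdmissible, topRight]; omega)))))
       (weightSeries_split_mul finiteFibers_topRight (fun v => v.1 + v.2.2.1 < v.2.1)
        (weightSeries_simplicial_mul
          (fun (a, b, c, d) => (b + c + d + 3, a + b + c + 2 * d + 5, d + 1, c + 1))
          (fun (f, g, p, q) => (g - f - p - 1, f - p - q - 1, q - 1, p - 1))
          11 1 2 3 5 ((1 + X) * (1 - X ^ 3) * (1 - X ^ 4)) (by decide) (by ring)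
          (by intros; simp [IsAdmissible, topRight]; omega))
        (weightSeries_simplicial_mul
          (fun (a, b, c, d) => (a + b + c + d + 4, a + b + c + 2 * d + 5, c + d + 2, b + 1))
          (fun (f, g, p, q) => (f - p - q - 1, q - 1, f + p - g - 1, g - f - 1))
          14 2 3 4 5 ((1 - X ^ 2) * (1 - X ^ 3)) (by decide) (by ring)
          (by intros; simp [IsAdmissible, topRight]; omega)))))
     (weightSeries_split_mul finiteFibers_topRight (fun v => v.1 < v.2.2.1 + v.2.2.2)
      (weightSeries_split_mul finiteFibers_topRight (fun v => v.1 < v.2.2.2)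
       (weightSeries_split_mul finiteFibers_topRight (fun v => v.2.1 < v.2.2.1)
        (weightSeries_simplicial_mul
          (fun (a, b, c, d) => (c + d + 2, d + 1, b + d + 2, a + c + d + 3))
          (fun (f, g, p, q) => (q - f - 1, p - g - 1, f - g - 1, g - 1))
          10 1 2 2 5 ((1 + X + X ^ 2) * (1 - X ^ 3) * (1 - X ^ 4)) (by decide) (by ring)
          (by intros; simp [IsAdmissible, topRight]; omega))
        (weightSeries_simplicial_mul
          (fun (a, b, c, d) => (b + c + d + 3, c + d + 2, d + 1, a + b + c + d + 4))
          (fun (f, g, p, q) => (q - f - 1, f - g - 1, g - p - 1, p - 1))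
          11 1 2 3 5 ((1 + X) * (1 - X ^ 3) * (1 - X ^ 4)) (by decide) (by ring)
          (by intros; simp [IsAdmissible, topRight]; omega)))
       (weightSeries_split_mul finiteFibers_topRight (fun v => v.2.1 < v.2.2.1)
        (weightSeries_split_mul finiteFibers_topRight (fun v => v.1 < v.2.1 + v.2.2.2)
         (weightSeries_simplicial_mul
           (fun (a, b, c, d) => (b + c + d + 3, c + d + 2, a + c + d + 3, b + d + 2))
           (fun (f, g, p, q) => (p - g - 1, f - g - 1, f - q - 1, g + q - f - 1))
           13 2 2 4 5 ((1 - X ^ 3) ^ 2) (by decide) (by ring)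
           (by intros; simp [IsAdmissible, topRight]; omega))
         (weightSeries_simplicial_mul
           (fun (a, b, c, d) => (b + c + d + 3, d + 1, a + c + d + 3, b + 1))
           (fun (f, g, p, q) => (p + q - f - 1, q - 1, f - g - q - 1, g - 1))
           11 2 2 3 4 ((1 - X ^ 3) * (1 - X ^ 5)) (by decide) (by ring)
           (by intros; simp [IsAdmissible, topRight]; omega)))
        (weightSeries_simplicial_mul
          (fun (a, b, c, d) => (a + b + c + d + 4, b + c + d + 3, c + d + 2, a + b + d + 3))
          (fun (f, g, p, q) => (f - g - 1, g - p - 1, f - q - 1, p + q - f - 1))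
          14 2 3 4 5 ((1 - X ^ 2) * (1 - X ^ 3)) (by decide) (by ring)
          (by intros; simp [IsAdmissible, topRight]; omega))))
      (weightSeries_split_mul finiteFibers_topRight (fun v => v.2.1 < v.2.2.1)
       (weightSeries_split_mul finiteFibers_topRight (fun v => v.1 < v.2.1 + v.2.2.1 + v.2.2.2)
        (weightSeries_simplicial_mul
          (fun (a, b, c, d) => (a + b + c + 2 * d + 5, c + d + 2, b + c + d + 3, a + 1))
          (fun (f, g, p, q) => (q - 1, p - g - 1, g + p + q - f - 1, f - p - q - 1))
          14 2 3 4 5 ((1 - X ^ 2) * (1 - X ^ 3)) (by decide) (by ring)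
          (by intros; simp [IsAdmissible, topRight]; omega))
        (weightSeries_simplicial_mul
          (fun (a, b, c, d) => (a + b + c + 2 * d + 5, d + 1, c + d + 2, b + 1))
          (fun (f, g, p, q) => (f - g - p - q - 1, q - 1, p - g - 1, g - 1))
          11 1 2 3 5 ((1 + X) * (1 - X ^ 3) * (1 - X ^ 4)) (by decide) (by ring)
          (by intros; simp [IsAdmissible, topRight]; omega)))
       (weightSeries_split_mul finiteFibers_topRight (fun v => v.1 < v.2.1 + v.2.2.2)
        (weightSeries_simplicial_mul
          (fun (a, b, c, d) => (a + b + c + d + 4, b + c + d + 3, d + 1, a + c + 2))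
          (fun (f, g, p, q) => (f - g - 1, f - p - q - 1, g + q - f - 1, p - 1))
          11 2 2 3 4 ((1 - X ^ 3) * (1 - X ^ 5)) (by decide) (by ring)
          (by intros; simp [IsAdmissible, topRight]; omega))
        (weightSeries_split_mul finiteFibers_topRight (fun v => v.1 < v.2.1 + v.2.2.1 + v.2.2.2)
         (weightSeries_simplicial_mul
           (fun (a, b, c, d) => (a + b + c + 2 * d + 5, b + c + d + 3, c + d + 2, a + 1))
           (fun (f, g, p, q) => (q - 1, g - p - 1, g + p + q - f - 1, f - g - q - 1))
           13 2 2 4 5 ((1 - X ^ 3) ^ 2) (by decide) (by ring)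
           (by intros; simp [IsAdmissible, topRight]; omega))
         (weightSeries_simplicial_mul
           (fun (a, b, c, d) => (a + b + c + 2 * d + 5, c + d + 2, d + 1, b + 1))
           (fun (f, g, p, q) => (f - g - p - q - 1, q - 1, g - p - 1, p - 1))
           10 1 2 2 5 ((1 + X + X ^ 2) * (1 - X ^ 3) * (1 - X ^ 4)) (by decide) (by ring)
           (by intros; simp [IsAdmissible, topRight]; omega))))))) ?_
  ring

/-! ### Semimagic squares and their normal forms -/

theorem HasMagicLines.comp_symmetry {x : Square} (hx : HasMagicLines x) {g : Equiv.Perm Cell}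
    (hg : g ∈ symmetries) : HasMagicLines (x ∘ g) := by
  obtain ⟨b, ρ, κ, rfl⟩ := mem_symmetries_iff.1 hg
  obtain ⟨s, hr, hc⟩ := hx
  refine ⟨s, fun i => ?_, fun j => ?_⟩ <;> cases b <;>
    simp only [Function.comp_apply, symmetryOf_apply, if_true, if_false, Bool.false_eq_true]
  · rw [Equiv.sum_comp κ fun j => x (ρ i, j), hr]
  · rw [Equiv.sum_comp ρ fun j => x (j, κ i), hc]
  · rw [Equiv.sum_comp ρ fun i => x (i, κ j), hc]
  · rw [Equiv.sum_comp κ fun i => x (ρ j, i), hr]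

theorem HasMagicLines.add_const {x : Square} (hx : HasMagicLines x) (a : ℤ) :
    HasMagicLines fun c => x c + a := by
  obtain ⟨s, hr, hc⟩ := hx
  exact ⟨s + 3 * a, fun i => by simp [Finset.sum_add_distrib, hr],
    fun j => by simp [Finset.sum_add_distrib, hc]⟩

@[simp]
theorem orderType_add_const (x : Square) (a : ℤ) : orderType (fun c => x c + a) = orderType x := by
  funext a b
  simp [orderType]

theorem IsReducedNormal.isNormalOrder {x : Square} (hx : IsReducedNormal x) :
    IsNormalOrder (orderType x) := by
  obtain ⟨-, hinj, hpos, h0, -, h2, -, h4, h5⟩ := hx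
  exact ⟨fun c hc => lt_of_le_of_ne (h0.trans_le (hpos c)) fun h => hc (hinj h.symm), h2, h4, h5⟩

theorem isSemimagic_squareOf_comp {v : ℕ × ℕ × ℕ × ℕ} (hv : IsAdmissible v)
    {g : Equiv.Perm Cell} (hg : g ∈ symmetries) (m : ℕ) :
    IsSemimagic fun c => squareOf v (g c) + (m + 1) := by
  obtain ⟨hmagic, hinj, hpos, -⟩ := isReducedNormal_squareOf hv
  refine ⟨(hmagic.comp_symmetry hg).add_const _, fun a b h => g.injective (hinj ?_), fun c => ?_⟩
  · simpa using h
  · have := hpos (g c)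
    dsimp only
    omega

theorem IsSemimagic.exists_squareOf_comp {x : Square} (hx : IsSemimagic x) :
    ∃ v, IsAdmissible v ∧ ∃ g ∈ symmetries, ∃ m : ℕ, x = fun c => squareOf v (g c) + (m + 1) := by
  obtain ⟨hmagic, hinj, hpos⟩ := hx
  obtain ⟨g, hg, hmin, h1, h2, h3⟩ := exists_symmetry_isNormalOrder hinj
  have hmin' (c : Cell) : x (g (0, 0)) ≤ x (g c) := by
    rcases eq_or_ne c (0, 0) with rfl | hc
    · exact le_rfl
    · exact (hmin c hc).le
  have hred : IsReducedNormal fun c => (x ∘ g) c + -x (g (0, 0)) := by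
    refine ⟨(hmagic.comp_symmetry hg).add_const _, fun a b h => g.injective (hinj ?_),
      fun c => ?_, ?_, ?_⟩
    · simpa using h
    · have := hmin' c
      simp only [Function.comp_apply]
      omega
    · simp
    · simpa using ⟨hmin (0, 1) (by decide), h1, hmin (1, 0) (by decide), h2, h3⟩
  obtain ⟨v, hv, hvx⟩ := exists_squareOf_eq hred
  refine ⟨v, hv, g⁻¹, inv_mem_symmetries hg, (x (g (0, 0)) - 1).toNat, funext fun c => ?_⟩
  have hgc : g (g⁻¹ c) = c := by rw [← Equiv.Perm.mul_apply, mul_inv_cancel, Equiv.Perm.one_apply]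
  have := hpos (g (0, 0))
  rw [hvx]
  dsimp only [Function.comp_apply]
  rw [hgc]
  omega

/-- The order type of a symmetric image of a reduced normal square determines the symmetry. -/
theorem symmetry_eq_of_orderType_eq {v v' : ℕ × ℕ × ℕ × ℕ} (hv : IsAdmissible v)
    (hv' : IsAdmissible v') {g g' : Equiv.Perm Cell} (hg : g ∈ symmetries) (hg' : g' ∈ symmetries)
    (h : orderType (squareOf v ∘ g) = orderType (squareOf v' ∘ g')) : g = g' := by
  have h1 (x : Square) (k : Equiv.Perm Cell) : (x ∘ k) ∘ (k⁻¹ : Equiv.Perm Cell) = x := by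
    funext c
    simp only [Function.comp_apply]
    rw [← Equiv.Perm.mul_apply, mul_inv_cancel, Equiv.Perm.one_apply]
  refine inv_injective (symmetry_unique (x := squareOf v ∘ g) (inv_mem_symmetries hg)
    (inv_mem_symmetries hg') ?_ ?_)
  · rw [h1]
    exact (isReducedNormal_squareOf hv).isNormalOrder
  · have h2 : orderType ((squareOf v ∘ g) ∘ (g'⁻¹ : Equiv.Perm Cell)) =
        orderType ((squareOf v' ∘ g') ∘ (g'⁻¹ : Equiv.Perm Cell)) :=
      funext₂ fun a b => congrFun₂ h (g'⁻¹ a) (g'⁻¹ b)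
    rw [h2, h1]
    exact (isReducedNormal_squareOf hv').isNormalOrder

/-- A semimagic square with entries below `t` is determined by its reduced normal form, the
symmetry that leads to it, and the amount by which its least entry exceeds `1`; the number `t`
exceeds the largest entry by `1` plus another natural number. The weight is written in the form in
which `weightSeries_prod` applies to it, with weight `0` for the symmetry. -/
theorem cubicCount_eq_ncard (t : ℕ) :
    cubicCount t = (symmetries ×ˢ {v | IsAdmissible v} ×ˢ (univ : Set ℕ) ×ˢ (univ : Set ℕ) ∩
      (fun d => 2 + (0 + (topRight d.2.1 + (1 * d.2.2.1 + 1 * d.2.2.2)))) ⁻¹' {t}).ncard := by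
  rw [cubicCount]
  let Φ : Equiv.Perm Cell × (ℕ × ℕ × ℕ × ℕ) × ℕ × ℕ → Square :=
    fun d c => squareOf d.2.1 (d.1 c) + (d.2.2.1 + 1)
  have hmax (v : ℕ × ℕ × ℕ × ℕ) (g : Equiv.Perm Cell) : squareOf v (g (g⁻¹ (0, 2))) =
      topRight v := by
    rw [← Equiv.Perm.mul_apply, mul_inv_cancel, Equiv.Perm.one_apply]
    simp [squareOf, topRight]
  have hmin (v : ℕ × ℕ × ℕ × ℕ) (g : Equiv.Perm Cell) : squareOf v (g (g⁻¹ (0, 0))) = 0 := by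
    rw [← Equiv.Perm.mul_apply, mul_inv_cancel, Equiv.Perm.one_apply]
    simp [squareOf]
  rw [← InjOn.ncard_image (f := Φ)]
  · congr 1
    ext x
    constructor
    · rintro ⟨hx, hlt⟩
      obtain ⟨v, hv, g, hg, m, rfl⟩ := hx.exists_squareOf_comp
      have := hlt (g⁻¹ (0, 2))
      dsimp only at this
      rw [hmax] at this
      refine ⟨(g, v, m, t - 2 - topRight v - m), ⟨⟨hg, hv, trivial, trivial⟩, ?_⟩, rfl⟩
      simp only [mem_preimage, mem_singleton_iff]
      omega
    · rintro ⟨⟨g, v, m, k⟩, ⟨⟨hg, hv, -, -⟩, ht⟩, rfl⟩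
      refine ⟨isSemimagic_squareOf_comp hv hg m, fun c => ?_⟩
      have := squareOf_le_topRight v (g c)
      simp only [mem_preimage, mem_singleton_iff] at ht
      simp only [Φ]
      omega
  · rintro ⟨g, v, m, k⟩ ⟨⟨hg, hv, -, -⟩, ht⟩ ⟨g', v', m', k'⟩ ⟨⟨hg', hv', -, -⟩, ht'⟩ h
    have h' (c : Cell) : squareOf v (g c) + (m + 1) = squareOf v' (g' c) + (m' + 1) := congrFun h c
    obtain rfl : g = g' := by
      refine symmetry_eq_of_orderType_eq hv hv' hg hg' (funext₂ fun a b => propext ?_)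
      have ha := h' a
      have hb := h' b
      simp only [orderType, Function.comp_apply]
      omega
    have h0 := h' (g⁻¹ (0, 0))
    rw [hmin, hmin] at h0
    obtain rfl : m = m' := by omega
    obtain rfl : v = v' := squareOf_injective (funext fun c => by
      have := h' (g⁻¹ c)
      rw [← Equiv.Perm.mul_apply, mul_inv_cancel, Equiv.Perm.one_apply] at this
      omega)
    simp only [mem_preimage, mem_singleton_iff] at ht ht'
    obtain rfl : k = k' := by omega
    rfl

theorem genFun_cubicCount :
    genFun cubicCount * (1 - X) ^ 2 = 72 * X ^ 2 * genFun reducedNormalCount := by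
  have hN := finiteFibers_nat one_pos
  have hA : FiniteFibers {v | IsAdmissible v} topRight := finiteFibers_topRight.mono (subset_univ _)
  have hS := FiniteFibers.of_finite finite_symmetries fun _ => 0
  have h : genFun cubicCount = weightSeries
      (symmetries ×ˢ {v | IsAdmissible v} ×ˢ (univ : Set ℕ) ×ˢ (univ : Set ℕ))
      fun d => 2 + (0 + (topRight d.2.1 + (1 * d.2.2.1 + 1 * d.2.2.2))) := by
    ext t
    simp only [genFun, weightSeries, coeff_mk, ← cubicCount_eq_ncard]
    split_ifs with ht
    · rw [ht, cubicCount_eq_ncard, eq_comm, Nat.cast_eq_zero]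
      convert ncard_empty (Equiv.Perm Cell × (ℕ × ℕ × ℕ × ℕ) × ℕ × ℕ) using 2
      refine eq_empty_of_forall_notMem ?_
      rintro d ⟨-, hd⟩
      simp only [mem_preimage, mem_singleton_iff] at hd
      omega
    · rfl
  have hgeom := weightSeries_nat one_pos
  rw [h, genFun_reducedNormalCount, weightSeries_const_add _
      fun d : Equiv.Perm Cell × (ℕ × ℕ × ℕ × ℕ) × ℕ × ℕ =>
        0 + (topRight d.2.1 + (1 * d.2.2.1 + 1 * d.2.2.2)),
    weightSeries_prod hS (hA.prod (hN.prod hN)), weightSeries_prod hA (hN.prod hN),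
    weightSeries_prod hN hN, weightSeries_zero, ncard_symmetries]
  rw [pow_one] at hgeom
  generalize weightSeries univ (fun n : ℕ => 1 * n) = G at hgeom ⊢
  generalize weightSeries {v | IsAdmissible v} topRight = A
  calc _ = 72 * X ^ 2 * A * (G * (1 - X)) ^ 2 := by push_cast; ring
    _ = _ := by rw [hgeom]; ring

/-! ### Order types -/

/-- The possible orders of the nine cells of a reduced normal square, from the least entry to the
largest one. The cells are numbered row by row. -/
def cellOrder : Fin 18 → Fin 9 → Fin 9 :=
  ![![0, 5, 7, 8, 1, 3, 4, 6, 2],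
    ![0, 5, 8, 1, 7, 3, 4, 6, 2],
    ![0, 5, 8, 7, 1, 3, 4, 6, 2],
    ![0, 5, 7, 8, 1, 4, 3, 6, 2],
    ![0, 5, 8, 1, 7, 4, 3, 6, 2],
    ![0, 5, 8, 7, 1, 4, 3, 6, 2],
    ![0, 5, 7, 8, 4, 1, 3, 6, 2],
    ![0, 5, 8, 7, 4, 1, 3, 6, 2],
    ![0, 8, 5, 1, 7, 3, 4, 6, 2],
    ![0, 8, 5, 7, 1, 3, 4, 6, 2],
    ![0, 8, 5, 1, 7, 4, 3, 6, 2],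
    ![0, 8, 5, 1, 4, 7, 3, 6, 2],
    ![0, 8, 5, 7, 1, 4, 3, 6, 2],
    ![0, 8, 5, 4, 1, 7, 3, 6, 2],
    ![0, 8, 4, 5, 1, 7, 3, 6, 2],
    ![0, 8, 5, 7, 4, 1, 3, 6, 2],
    ![0, 8, 5, 4, 7, 1, 3, 6, 2],
    ![0, 8, 4, 5, 7, 1, 3, 6, 2]]

/-- The `k`-th cell in the given order. -/
def chain (i : Fin 18) (k : Fin 9) : Cell := finProdFinEquiv.symm (cellOrder i k)

/-- The parameters of a reduced normal square for each of the orders `cellOrder`. -/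
def sample : Fin 18 → ℕ × ℕ × ℕ × ℕ :=
  ![(1, 3, 1, 2), (1, 2, 3, 2), (2, 3, 2, 3), (2, 5, 2, 1), (2, 3, 4, 1), (2, 3, 2, 1),
    (3, 5, 1, 1), (4, 5, 2, 1), (2, 1, 2, 3), (3, 2, 1, 4), (3, 2, 3, 2), (3, 1, 3, 1),
    (4, 3, 2, 3), (5, 2, 3, 1), (5, 1, 2, 1), (4, 3, 1, 2), (5, 3, 2, 1), (5, 2, 1, 1)]

theorem chain_surjective (i : Fin 18) : Function.Surjective (chain i) := by
  revert i
  decide +kernel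

/-- The entries of `squareOf v`, row by row. -/
def entryVector (v : ℕ × ℕ × ℕ × ℕ) : Fin 9 → ℕ :=
  ![0, v.1 + v.2.1, v.1 + v.2.1 + 2 * v.2.2.1 + v.2.2.2,
    v.1 + v.2.1 + v.2.2.1, v.2.1 + v.2.2.1 + v.2.2.2, v.1,
    v.1 + v.2.1 + v.2.2.1 + v.2.2.2, v.1 + v.2.2.1, v.2.1]

theorem squareOf_finProdFinEquiv_symm (v : ℕ × ℕ × ℕ × ℕ) (c : Fin 9) :
    squareOf v (finProdFinEquiv.symm c) = entryVector v c := by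
  fin_cases c <;> rfl

/-- Each of the eighteen chambers of the hyperplane arrangement has a single order type. -/
theorem exists_strictMono_squareOf_comp_chain {v : ℕ × ℕ × ℕ × ℕ} (hv : IsAdmissible v) :
    ∃ i, StrictMono (squareOf v ∘ chain i) := by
  obtain ⟨f, g, p, q⟩ := v
  obtain ⟨⟨hf, hg, hp, hq⟩, hfg, hfq, hfpq, hgp, hgfp, hfgq, hfgpq⟩ := hv
  have of_lt_succ (i : Fin 18) (h : ∀ k : Fin 8, entryVector (f, g, p, q)
      (cellOrder i k.castSucc) < entryVector (f, g, p, q) (cellOrder i k.succ)) :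
      ∃ i, StrictMono (squareOf (f, g, p, q) ∘ chain i) :=
    ⟨i, Fin.strictMono_iff_lt_succ.2 fun k => by
      simpa only [Function.comp_apply, chain, squareOf_finProdFinEquiv_symm, Nat.cast_lt] using h k⟩
  rcases lt_or_gt_of_ne hfg with h | h
  · rcases lt_or_gt_of_ne hfq with h | h
    · rcases lt_or_gt_of_ne hgfp with h | h
      · exact of_lt_succ 0 fun k => by
          fin_cases k <;> simp [entryVector, cellOrder] <;> omega
      · rcases lt_or_gt_of_ne hgp with h | h
        · exact of_lt_succ 1 fun k => by
            fin_cases k <;> simp [entryVector, cellOrder] <;> omega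
        · exact of_lt_succ 2 fun k => by
            fin_cases k <;> simp [entryVector, cellOrder] <;> omega
    · rcases lt_or_gt_of_ne hfpq with h | h
      · rcases lt_or_gt_of_ne hgfp with h | h
        · exact of_lt_succ 3 fun k => by
            fin_cases k <;> simp [entryVector, cellOrder] <;> omega
        · rcases lt_or_gt_of_ne hgp with h | h
          · exact of_lt_succ 4 fun k => by
              fin_cases k <;> simp [entryVector, cellOrder] <;> omega
          · exact of_lt_succ 5 fun k => by
              fin_cases k <;> simp [entryVector, cellOrder] <;> omega
      · rcases lt_or_gt_of_ne hgfp with h | h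
        · exact of_lt_succ 6 fun k => by
            fin_cases k <;> simp [entryVector, cellOrder] <;> omega
        · exact of_lt_succ 7 fun k => by
            fin_cases k <;> simp [entryVector, cellOrder] <;> omega
  · rcases lt_or_gt_of_ne hfpq with h | h
    · rcases lt_or_gt_of_ne hfq with h | h
      · rcases lt_or_gt_of_ne hgp with h | h
        · exact of_lt_succ 8 fun k => by
            fin_cases k <;> simp [entryVector, cellOrder] <;> omega
        · exact of_lt_succ 9 fun k => by
            fin_cases k <;> simp [entryVector, cellOrder] <;> omega
      · rcases lt_or_gt_of_ne hgp with h | h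
        · rcases lt_or_gt_of_ne hfgq with h | h
          · exact of_lt_succ 10 fun k => by
              fin_cases k <;> simp [entryVector, cellOrder] <;> omega
          · exact of_lt_succ 11 fun k => by
              fin_cases k <;> simp [entryVector, cellOrder] <;> omega
        · exact of_lt_succ 12 fun k => by
            fin_cases k <;> simp [entryVector, cellOrder] <;> omega
    · rcases lt_or_gt_of_ne hgp with h | h
      · rcases lt_or_gt_of_ne hfgpq with h | h
        · exact of_lt_succ 13 fun k => by
            fin_cases k <;> simp [entryVector, cellOrder] <;> omega
        · exact of_lt_succ 14 fun k => by
            fin_cases k <;> simp [entryVector, cellOrder] <;> omega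
      · rcases lt_or_gt_of_ne hfgq with h | h
        · exact of_lt_succ 15 fun k => by
            fin_cases k <;> simp [entryVector, cellOrder] <;> omega
        · rcases lt_or_gt_of_ne hfgpq with h | h
          · exact of_lt_succ 16 fun k => by
              fin_cases k <;> simp [entryVector, cellOrder] <;> omega
          · exact of_lt_succ 17 fun k => by
              fin_cases k <;> simp [entryVector, cellOrder] <;> omega

theorem isAdmissible_sample (i : Fin 18) : IsAdmissible (sample i) := by
  fin_cases i <;> simp [sample, IsAdmissible]

theorem strictMono_sample (i : Fin 18) : StrictMono (squareOf (sample i) ∘ chain i) := by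
  rw [Fin.strictMono_iff_lt_succ]
  revert i
  decide +kernel

theorem orderType_eq_of_strictMono_comp {n : ℕ} {σ : Fin n → Cell} (hσ : Function.Surjective σ)
    {x y : Square} (hx : StrictMono (x ∘ σ)) (hy : StrictMono (y ∘ σ)) :
    orderType x = orderType y := by
  funext a b
  obtain ⟨k, rfl⟩ := hσ a
  obtain ⟨l, rfl⟩ := hσ b
  exact propext (hx.lt_iff_lt.trans hy.lt_iff_lt.symm)

theorem orderType_sample_injective :
    Function.Injective fun i => orderType (squareOf (sample i)) := by
  have h : ∀ i j, i ≠ j → ∃ a b, squareOf (sample i) a < squareOf (sample i) b ∧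
      ¬ squareOf (sample j) a < squareOf (sample j) b := by decide +kernel
  intro i j hij
  by_contra hne
  obtain ⟨a, b, h1, h2⟩ := h i j hne
  exact h2 ((congrFun₂ hij a b).mp h1)

/-- The order type of the image under the symmetry `d.1` of the `d.2`-th sample square. -/
def orderTypeOf (d : Equiv.Perm Cell × Fin 18) : Cell → Cell → Prop :=
  orderType (squareOf (sample d.2) ∘ d.1)

theorem bijOn_orderTypeOf : BijOn orderTypeOf (symmetries ×ˢ univ) orderTypes := by
  refine ⟨?_, ?_, ?_⟩
  · rintro ⟨g, i⟩ ⟨hg, -⟩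
    exact ⟨_, isSemimagic_squareOf_comp (isAdmissible_sample i) hg 0,
      (orderType_add_const (squareOf (sample i) ∘ g) _).symm⟩
  · rintro ⟨g, i⟩ ⟨hg, -⟩ ⟨g', j⟩ ⟨hg', -⟩ h
    obtain rfl : g = g' :=
      symmetry_eq_of_orderType_eq (isAdmissible_sample i) (isAdmissible_sample j) hg hg' h
    have : orderType (squareOf (sample i)) = orderType (squareOf (sample j)) := by
      funext a b
      simpa [orderTypeOf, orderType] using congrFun₂ h (g.symm a) (g.symm b)
    rw [orderType_sample_injective this]
  · rintro R ⟨x, hx, rfl⟩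
    obtain ⟨v, hv, g, hg, m, rfl⟩ := hx.exists_squareOf_comp
    obtain ⟨i, hi⟩ := exists_strictMono_squareOf_comp_chain hv
    have h := orderType_eq_of_strictMono_comp (chain_surjective i) (strictMono_sample i) hi
    refine ⟨(g, i), ⟨hg, trivial⟩, ?_⟩
    exact (funext₂ fun a b => congrFun₂ h (g a) (g b)).trans
      (orderType_add_const (squareOf v ∘ g) _).symm

theorem ncard_orderTypes : orderTypes.ncard = 1296 := by
  rw [← bijOn_orderTypeOf.image_eq, bijOn_orderTypeOf.injOn.ncard_image, ncard_prod,
    ncard_symmetries, ncard_univ, Nat.card_eq_fintype_card, Fintype.card_fin]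

theorem symmetryClass_orderTypeOf {g : Equiv.Perm Cell} (hg : g ∈ symmetries) (i : Fin 18) :
    symmetryClass (orderTypeOf (g, i)) = (fun h => orderTypeOf (h, i)) '' symmetries := by
  ext R
  constructor
  · rintro ⟨h, hh, rfl⟩
    exact ⟨g * h, mul_mem_symmetries hg hh, rfl⟩
  · rintro ⟨h, hh, rfl⟩
    refine ⟨g⁻¹ * h, mul_mem_symmetries (inv_mem_symmetries hg) hh, ?_⟩
    funext a b
    simp [orderTypeOf, orderType]

theorem ncard_symmetryClasses : (symmetryClass '' orderTypes).ncard = 18 := by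
  have himage : symmetryClass '' orderTypes =
      range fun i => (fun h => orderTypeOf (h, i)) '' symmetries := by
    rw [← bijOn_orderTypeOf.image_eq]
    ext C
    constructor
    · rintro ⟨-, ⟨⟨g, i⟩, ⟨hg, -⟩, rfl⟩, rfl⟩
      exact ⟨i, (symmetryClass_orderTypeOf hg i).symm⟩
    · rintro ⟨i, rfl⟩
      exact ⟨_, ⟨(1, i), ⟨one_mem_symmetries, trivial⟩, rfl⟩,
        symmetryClass_orderTypeOf one_mem_symmetries i⟩
  -- A class that contains `orderTypeOf (1, i)` determines `i`.
  have hinj : Function.Injective fun i => (fun h => orderTypeOf (h, i)) '' symmetries := by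
    intro i j hij
    obtain ⟨h, hh, heq⟩ := hij.subset ⟨1, one_mem_symmetries, rfl⟩
    exact (congrArg Prod.snd
      (bijOn_orderTypeOf.injOn (x₁ := (h, j)) (x₂ := (1, i)) ⟨hh, trivial⟩
        ⟨one_mem_symmetries, trivial⟩ heq)).symm
  rw [himage, ← image_univ, ncard_image_of_injective _ hinj, ncard_univ,
    Nat.card_eq_fintype_card, Fintype.card_fin]

/-! ### The quasipolynomial -/

/-- The coefficients of `(1 - x ^ 2) ^ 2 * (1 - x ^ 3) ^ 2 * (1 - x ^ 4) * (1 - x ^ 5)`. -/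
def denomCoeff (k : ℕ) : ℚ :=
  [1, 0, -2, -2, 0, 3, 3, 2, -1, -4, -4, -1, 2, 3, 3, 0, -2, -2, 0, 1].getD k 0

/-- The coefficients of the numerator polynomial. -/
def numCoeff (k : ℕ) : ℚ :=
  [0, 0, 0, 0, 0, 0, 0, 0, 0, 0, 72, 288, 792, 1872, 3312, 4680, 5328, 4968, 3312, 1296].getD k 0

/-- The value at `t` of the constituent of `t`. -/
def quasiPoly (t : ℕ) : ℚ :=
  3 / 10 * t ^ 5 - 75 / 8 * t ^ 4 + 331 / 3 * t ^ 3 - c₂ t * t ^ 2 + c₁ t * t - c₀ t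

theorem eval_constituent (r t : ℕ) : (constituent r).eval (t : ℚ) =
    3 / 10 * t ^ 5 - 75 / 8 * t ^ 4 + 331 / 3 * t ^ 3 - c₂ r * t ^ 2 + c₁ r * t - c₀ r := by
  simp [constituent]

theorem periodic_c₂ : Function.Periodic c₂ 2 := fun t => by
  simp [c₂, Nat.even_add]

theorem periodic_c₁ : Function.Periodic c₁ 6 := fun t => by
  simp [c₁]

theorem periodic_c₀ : Function.Periodic c₀ 60 := fun t => by
  simp [c₀]

theorem constituent_mod (t : ℕ) : constituent (t % 60) = constituent t := by
  have h₂ : c₂ (t % 60) = c₂ t := (periodic_c₂.nat_mul 30).map_mod_nat t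
  have h₁ : c₁ (t % 60) = c₁ t := (periodic_c₁.nat_mul 10).map_mod_nat t
  rw [constituent, constituent, h₂, h₁, periodic_c₀.map_mod_nat]

theorem eval_constituent_self (t : ℕ) : (constituent t).eval (t : ℚ) = quasiPoly t :=
  eval_constituent t t

theorem coeff_mul_sum_C_mul_X_pow (F : PowerSeries ℚ) (d : ℕ → ℚ) (m n : ℕ) :
    coeff n (F * ∑ k ∈ Finset.range m, C (d k) * X ^ k) =
      ∑ k ∈ Finset.range m, if k ≤ n then d k * coeff (n - k) F else 0 := by
  rw [Finset.mul_sum, map_sum]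
  refine Finset.sum_congr rfl fun k _ => ?_
  rw [mul_left_comm, coeff_C_mul, coeff_mul_X_pow']
  split_ifs <;> simp

/-- The sequence `quasiPoly` satisfies the linear recurrence whose characteristic polynomial is the
denominator. The terms of the recurrence are collected by powers of `m`, and each of the coefficient
functions, being periodic, vanishes because it vanishes for `m < 60`. -/
theorem quasiPoly_recurrence (m : ℕ) :
    ∑ k ∈ Finset.range 20, denomCoeff k * quasiPoly (m + 19 - k) = 0 := by
  -- The denominator is palindromic.
  have hflip : ∑ k ∈ Finset.range 20, denomCoeff k * quasiPoly (m + 19 - k) =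
      ∑ j ∈ Finset.range 20, denomCoeff j * quasiPoly (m + j) := by
    rw [← Finset.sum_range_reflect]
    refine Finset.sum_congr rfl fun j hj => ?_
    have hj' := Finset.mem_range.1 hj
    congr 1
    · interval_cases j <;> rfl
    · congr 1
      omega
  -- The denominator has a zero of order six at `1`, so its recurrence annihilates polynomials of
  -- degree at most five.
  have hpoly (i : ℕ) (hi : i < 6) :
      ∑ j ∈ Finset.range 20, denomCoeff j * (j : ℚ) ^ i = 0 := by
    interval_cases i <;> decide +kernel
  have hmod (f : ℕ → ℚ) (hf : Function.Periodic f 60) (h : ∀ m < 60, f m = 0) : f m = 0 := by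
    rw [← hf.map_mod_nat m]
    exact h _ (Nat.mod_lt _ (by norm_num))
  have p₂ (n : ℕ) : c₂ (n + 60) = c₂ n := periodic_c₂.nat_mul 30 n
  have p₁ (n : ℕ) : c₁ (n + 60) = c₁ n := periodic_c₁.nat_mul 10 n
  have p₀ (n : ℕ) : c₀ (n + 60) = c₀ n := periodic_c₀ n
  have h₂ : ∑ j ∈ Finset.range 20, denomCoeff j * c₂ (m + j) = 0 :=
    hmod (fun m => ∑ j ∈ Finset.range 20, denomCoeff j * c₂ (m + j))
      (fun m => by simp only [add_right_comm m 60, p₂]) (by decide +kernel)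
  have h₁ : ∑ j ∈ Finset.range 20, denomCoeff j * (c₁ (m + j) - 2 * j * c₂ (m + j)) = 0 :=
    hmod (fun m => ∑ j ∈ Finset.range 20, denomCoeff j * (c₁ (m + j) - 2 * j * c₂ (m + j)))
      (fun m => by simp only [add_right_comm m 60, p₂, p₁]) (by decide +kernel)
  have h₀ : ∑ j ∈ Finset.range 20,
      denomCoeff j * (j * c₁ (m + j) - j ^ 2 * c₂ (m + j) - c₀ (m + j)) = 0 :=
    hmod (fun m => ∑ j ∈ Finset.range 20,
        denomCoeff j * (j * c₁ (m + j) - j ^ 2 * c₂ (m + j) - c₀ (m + j)))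
      (fun m => by simp only [add_right_comm m 60, p₂, p₁, p₀]) (by decide +kernel)
  have expand (j : ℕ) : denomCoeff j * quasiPoly (m + j) =
      (3 / 10 * m ^ 5 - 75 / 8 * m ^ 4 + 331 / 3 * m ^ 3) * (denomCoeff j * (j : ℚ) ^ 0) +
      (3 / 2 * m ^ 4 - 75 / 2 * m ^ 3 + 331 * m ^ 2) * (denomCoeff j * (j : ℚ) ^ 1) +
      (3 * m ^ 3 - 225 / 4 * m ^ 2 + 331 * m) * (denomCoeff j * (j : ℚ) ^ 2) +
      (3 * m ^ 2 - 75 / 2 * m + 331 / 3) * (denomCoeff j * (j : ℚ) ^ 3) +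
      (3 / 2 * m - 75 / 8) * (denomCoeff j * (j : ℚ) ^ 4) +
      3 / 10 * (denomCoeff j * (j : ℚ) ^ 5) -
      m ^ 2 * (denomCoeff j * c₂ (m + j)) +
      m * (denomCoeff j * (c₁ (m + j) - 2 * j * c₂ (m + j))) +
      denomCoeff j * (j * c₁ (m + j) - j ^ 2 * c₂ (m + j) - c₀ (m + j)) := by
    rw [quasiPoly]
    push_cast
    ring
  rw [hflip]
  simp only [expand, Finset.sum_add_distrib, Finset.sum_sub_distrib, ← Finset.mul_sum, h₀, h₁, h₂]
  rw [hpoly 0 (by norm_num), hpoly 1 (by norm_num), hpoly 2 (by norm_num), hpoly 3 (by norm_num),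
    hpoly 4 (by norm_num), hpoly 5 (by norm_num)]
  ring

/-- The generating function of `quasiPoly`, with the value at `0` replaced by `0`. Beyond the
degree of the numerator the identity is the recurrence. -/
theorem mul_denom_of_quasiPoly :
    PowerSeries.mk (fun t => if t = 0 then 0 else quasiPoly t) *
        ((1 - X ^ 2) ^ 2 * (1 - X ^ 3) ^ 2 * (1 - X ^ 4) * (1 - X ^ 5)) =
      72 * X ^ 10 *
        (18 * X ^ 9 + 46 * X ^ 8 + 69 * X ^ 7 + 74 * X ^ 6 + 65 * X ^ 5 + 46 * X ^ 4
          + 26 * X ^ 3 + 11 * X ^ 2 + 4 * X + 1) := by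
  have hC (n : ℕ) [n.AtLeastTwo] : C (OfNat.ofNat n : ℚ) = OfNat.ofNat n := map_ofNat C n
  have hD : ((1 - X ^ 2) ^ 2 * (1 - X ^ 3) ^ 2 * (1 - X ^ 4) * (1 - X ^ 5) : PowerSeries ℚ) =
      ∑ k ∈ Finset.range 20, C (denomCoeff k) * X ^ k := by
    simp [Finset.sum_range_succ, denomCoeff, hC]
    ring
  have hN : (72 * X ^ 10 * (18 * X ^ 9 + 46 * X ^ 8 + 69 * X ^ 7 + 74 * X ^ 6 + 65 * X ^ 5
      + 46 * X ^ 4 + 26 * X ^ 3 + 11 * X ^ 2 + 4 * X + 1) : PowerSeries ℚ) =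
      1 * ∑ k ∈ Finset.range 20, C (numCoeff k) * X ^ k := by
    simp [Finset.sum_range_succ, numCoeff, hC]
    ring
  rw [hD, hN]
  ext n
  rw [coeff_mul_sum_C_mul_X_pow, coeff_mul_sum_C_mul_X_pow]
  simp only [coeff_mk, coeff_one]
  rcases lt_or_ge n 20 with hn | hn
  · revert n
    decide +kernel
  -- From here on the recurrence does not involve the exceptional value at `0`.
  · obtain ⟨m, rfl⟩ : ∃ m, n = m + 1 + 19 := ⟨n - 20, by omega⟩
    rw [Finset.sum_congr rfl fun k hk => ?_, quasiPoly_recurrence (m + 1),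
      Finset.sum_eq_zero fun k hk => ?_]
    · have := Finset.mem_range.1 hk
      rw [if_neg (by omega : ¬ m + 1 + 19 - k = 0), mul_zero, ite_self]
    · have := Finset.mem_range.1 hk
      rw [if_pos (by omega), if_neg (by omega)]

theorem genFun_cubicCount_mul_denom :
    genFun cubicCount * ((1 - X ^ 2) ^ 2 * (1 - X ^ 3) ^ 2 * (1 - X ^ 4) * (1 - X ^ 5)) =
      72 * X ^ 10 *
        (18 * X ^ 9 + 46 * X ^ 8 + 69 * X ^ 7 + 74 * X ^ 6 + 65 * X ^ 5 + 46 * X ^ 4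
          + 26 * X ^ 3 + 11 * X ^ 2 + 4 * X + 1) := by
  have h1 := genFun_cubicCount
  have h2 := weightSeries_isAdmissible
  rw [genFun_reducedNormalCount] at h1
  have hne : (1 - X : PowerSeries ℚ) ^ 2 ≠ 0 := pow_ne_zero _ fun h => by
    simpa using congrArg constantCoeff h
  refine mul_left_cancel₀ hne ?_
  linear_combination ((1 - X ^ 2) ^ 2 * (1 - X ^ 3) ^ 2 * (1 - X ^ 4) * (1 - X ^ 5)) * h1 +
    72 * X ^ 2 * h2

theorem cubicCount_eq_quasiPoly {t : ℕ} (ht : 0 < t) : (cubicCount t : ℚ) = quasiPoly t := by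
  have hne : ((1 - X ^ 2) ^ 2 * (1 - X ^ 3) ^ 2 * (1 - X ^ 4) * (1 - X ^ 5) : PowerSeries ℚ) ≠ 0 :=
    fun h => by simpa using congrArg constantCoeff h
  have h := congrArg (coeff t)
    (mul_right_cancel₀ hne (genFun_cubicCount_mul_denom.trans mul_denom_of_quasiPoly.symm))
  simpa [genFun, ht.ne'] using h

theorem isConstituents_constituent : IsConstituents cubicCount 60 constituent :=
  ⟨by norm_num, fun t ht => by
    rw [constituent_mod, eval_constituent_self, cubicCount_eq_quasiPoly ht]⟩

/-- Any constituents of `cubicCount`, for whatever modulus, agree with the ones given, since the two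
polynomials belonging to `r` agree at infinitely many places. -/
theorem IsConstituents.eq_constituent {q : ℕ} {P : ℕ → Polynomial ℚ}
    (h : IsConstituents cubicCount q P) (r : ℕ) : P (r % q) = constituent r := by
  obtain ⟨hq, hP⟩ := h
  have hinj : Function.Injective fun k : ℕ => ((r + 60 * q * (k + 1) : ℕ) : ℚ) := by
    intro a b hab
    have hab' : r + 60 * q * (a + 1) = r + 60 * q * (b + 1) := Nat.cast_injective hab
    have := Nat.eq_of_mul_eq_mul_left (by positivity) (Nat.add_left_cancel hab')
    omega
  refine Polynomial.eq_of_infinite_eval_eq _ _ ((infinite_range_of_injective hinj).mono ?_)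
  rintro - ⟨k, rfl⟩
  have ht : 0 < r + 60 * q * (k + 1) := by positivity
  have h1 := hP _ ht
  have h2 := isConstituents_constituent.2 _ ht
  rw [show (r + 60 * q * (k + 1)) % q = r % q by
    rw [mul_comm 60 q, mul_assoc, Nat.add_mul_mod_self_left]] at h1
  rw [mul_assoc, Nat.add_mul_mod_self_left, constituent_mod, ← mul_assoc] at h2
  exact h1.symm.trans h2

theorem isConstituents_iff (P : ℕ → Polynomial ℚ) :
    IsConstituents cubicCount 60 P ↔ ∀ r < 60, P r = constituent r := by
  constructor
  · intro h r hr
    rw [← h.eq_constituent r, Nat.mod_eq_of_lt hr]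
  · intro h
    refine ⟨by norm_num, fun t ht => ?_⟩
    rw [h _ (Nat.mod_lt _ (by norm_num)), isConstituents_constituent.2 t ht]

theorem coeff_zero_constituent (r : ℕ) : (constituent r).coeff 0 = -c₀ r := by
  simp [constituent, Polynomial.coeff_X_zero, Polynomial.coeff_C_zero, Polynomial.mul_coeff_zero]

theorem natDegree_constituent (r : ℕ) : (constituent r).natDegree = 5 := by
  rw [constituent]
  compute_degree!

theorem hasMinimalPeriod_c₁ : HasMinimalPeriod c₁ 6 := by
  refine ⟨⟨by norm_num, periodic_c₁⟩, ?_⟩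
  rintro q ⟨hq, hper⟩
  by_contra! hlt
  have h : ∀ q < 6, 0 < q → ∃ t < 6, c₁ (t + q) ≠ c₁ t := by decide +kernel
  obtain ⟨t, -, ht⟩ := h q hlt hq
  exact ht (hper t)

theorem hasMinimalPeriod_c₀ : HasMinimalPeriod c₀ 60 := by
  refine ⟨⟨by norm_num, periodic_c₀⟩, ?_⟩
  rintro q ⟨hq, hper⟩
  by_contra! hlt
  have h : ∀ q < 60, 0 < q → ∃ t < 60, c₀ (t + q) ≠ c₀ t := by decide +kernel
  obtain ⟨t, -, ht⟩ := h q hlt hq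
  exact ht (hper t)

/-- Constituents with respect to `q` are those given, whence `c₀` has period `q`. -/
theorem hasQuasiPeriod_cubicCount : HasQuasiPeriod cubicCount 60 := by
  refine ⟨⟨constituent, isConstituents_constituent⟩, ?_⟩
  rintro q ⟨P, hP⟩
  refine hasMinimalPeriod_c₀.2 ⟨hP.1, fun t => ?_⟩
  rw [← neg_inj, ← coeff_zero_constituent, ← coeff_zero_constituent, ← hP.eq_constituent,
    ← hP.eq_constituent, Nat.add_mod_right]

end SemimagicSquare

open SemimagicSquare PowerSeries in
theorem mainTheorem3 :
    -- the generating function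
    (genFun cubicCount * (1 - X) ^ 2 = 72 * X ^ 2 * genFun reducedNormalCount ∧
      genFun cubicCount *
          ((1 - X ^ 2) ^ 2 * (1 - X ^ 3) ^ 2 * (1 - X ^ 4) * (1 - X ^ 5)) =
        72 * X ^ 10 *
          (18 * X ^ 9 + 46 * X ^ 8 + 69 * X ^ 7 + 74 * X ^ 6 + 65 * X ^ 5 + 46 * X ^ 4
            + 26 * X ^ 3 + 11 * X ^ 2 + 4 * X + 1)) ∧
    -- the quasipolynomial: period, constituents, degree, periods of the varying coefficients
    HasQuasiPeriod cubicCount 60 ∧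
    (∀ P : ℕ → Polynomial ℚ,
      IsConstituents cubicCount 60 P ↔ ∀ r < 60, P r = constituent r) ∧
    (∀ r < 60, (constituent r).natDegree = 5) ∧
    HasMinimalPeriod c₁ 6 ∧
    HasMinimalPeriod c₀ 60 ∧
    -- the principal constituent and the order types
    (constituent 0 =
        Polynomial.C (3 / 10) * Polynomial.X ^ 5 - Polynomial.C (75 / 8) * Polynomial.X ^ 4
          + Polynomial.C (331 / 3) * Polynomial.X ^ 3 - Polynomial.C (5989 / 10) * Polynomial.X ^ 2
          + Polynomial.C 1464 * Polynomial.X - Polynomial.C 1296) ∧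
    (constituent 0).coeff 0 = -1296 ∧
    orderTypes.ncard = 1296 ∧
    symmetries.ncard = 72 ∧
    (symmetryClass '' orderTypes).ncard = 18 := by
  refine ⟨⟨genFun_cubicCount, genFun_cubicCount_mul_denom⟩, hasQuasiPeriod_cubicCount,
    isConstituents_iff, fun r _ => natDegree_constituent r, hasMinimalPeriod_c₁,
    hasMinimalPeriod_c₀, ?_, ?_, ncard_orderTypes, ncard_symmetries, ncard_symmetryClasses⟩
  · simp [constituent, c₂, c₁, c₀, c₀Table]
  · simp [coeff_zero_constituent, c₀, c₀Table]
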